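/- Let $T:\mathbb R^2\to\mathbb R^2$ be an invertible linear map with inverse $T^{-1}=\begin{pmatrix} a & b\\ c & d\end{pmatrix}$, and assume $ab\neq 0$. For $\mu,\nu\in\mathcal S'(\mathbb R)$ let $W_T(\mu,\nu)=\mathcal F_2\big(T(\mu\otimes\overline{\nu})\big)\in\mathcal S'(\mathbb R^2)$ be the cross matrix-Wigner transform, where $\overline\nu$ is the complex conjugate distribution, $TF=F\circ T$ is the change of variables, $\mathcal F_2F(x,\omega)=\int_{\mathbb R}F(x,t)e^{-2\pi i\omega t}\,dt$ is the partial Fourier transform in the second variable, and each operation is extended to tempered distributions as usual. A set $S\subset\mathbb R$ is uniformly discrete if there is $\delta>0$ with $|r-s|\geq\delta$ for all distinct $r,s\in S$. **Theorem.** Let $\mu,\nu\in\mathcal S'(\mathbb R)\setminus\{0\}$. Suppose that there are uniformly discrete sets $A,B\subset\mathbb R$ and complex numbers $c_{r,s}$ such that $$W_T(\mu,\nu)=\sum_{(r,s)\in A\times B}c_{r,s}\,\delta_{(r,s)},$$ the series converging unconditionally in $\mathcal S'(\mathbb R^2)$ (that is, tested against each Schwartz function). Then each of $\mu$ and $\nu$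 is a (complex Radon) measure whose support is contained in a uniformly discrete set. -/

import Mathlib

open MeasureTheory
open scoped SchwartzMap FourierTransform LineDeriv ContDiff

noncomputable section

namespace MatrixWigner

/-! ### A criterion for producing Schwartz functions -/

section Criterion

variable {D E : Type*} [NormedAddCommGroup D] [NormedSpace ℝ D]
  [NormedAddCommGroup E] [NormedSpace ℝ E] {ι : Type*} [Fintype ι]

/-- The family `A` is stable under differentiation and has rapid decay controlled by
continuous seminorms. -/
structure SchwartzCriterion (A : 𝓢(E, ℂ) → D → ℂ) (L : ι → D →L[ℝ] ℝ)
    (P : ι → 𝓢(E, ℂ) →L[ℂ] 𝓢(E, ℂ)) : Prop where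
  add : ∀ f g x, A (f + g) x = A f x + A g x
  smul : ∀ (a : ℂ) f x, A (a • f) x = a • A f x
  deriv : ∀ f x, HasFDerivAt (A f) (∑ i, (L i).smulRight (A (P i f) x)) x
  bound : ∀ k : ℕ, ∃ q : Seminorm ℂ 𝓢(E, ℂ), Continuous q ∧ ∀ f x, ‖x‖ ^ k * ‖A f x‖ ≤ q f

variable {A : 𝓢(E, ℂ) → D → ℂ} {L : ι → D →L[ℝ] ℝ} {P : ι → 𝓢(E, ℂ) →L[ℂ] 𝓢(E, ℂ)}

theorem SchwartzCriterion.fderiv_eq (h : SchwartzCriterion A L P) (f : 𝓢(E, ℂ)) :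
    fderiv ℝ (A f) = fun x ↦ ∑ i, ContinuousLinearMap.smulRightL ℝ D ℂ (L i) (A (P i f) x) := by
  ext1 x
  rw [(h.deriv f x).fderiv]
  rfl

theorem SchwartzCriterion.contDiff_nat (h : SchwartzCriterion A L P) (n : ℕ) (f : 𝓢(E, ℂ)) :
    ContDiff ℝ n (A f) := by
  induction n generalizing f with
  | zero =>
    rw [Nat.cast_zero, contDiff_zero]
    exact continuous_iff_continuousAt.2 fun x ↦ (h.deriv f x).continuousAt
  | succ n ih =>
    rw [Nat.cast_succ, contDiff_succ_iff_fderiv]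
    refine ⟨fun x ↦ (h.deriv f x).differentiableAt, by simp, ?_⟩
    rw [h.fderiv_eq]
    exact ContDiff.sum fun i _ ↦ (ContinuousLinearMap.contDiff _).comp (ih (P i f))

theorem SchwartzCriterion.contDiff (h : SchwartzCriterion A L P) (f : 𝓢(E, ℂ)) :
    ContDiff ℝ ∞ (A f) :=
  contDiff_infty.2 fun n ↦ h.contDiff_nat n f

theorem seminorm_sum_apply {V κ : Type*} [AddCommGroup V] [Module ℂ V] (s : Finset κ)
    (p : κ → Seminorm ℂ V) (v : V) : (∑ i ∈ s, p i) v = ∑ i ∈ s, p i v := by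
  classical
  induction s using Finset.induction_on with
  | empty => simp
  | insert a t ha ih => rw [Finset.sum_insert ha, Finset.sum_insert ha, add_apply, ih]

theorem SchwartzCriterion.bound_iterated (h : SchwartzCriterion A L P) (k n : ℕ) :
    ∃ q : Seminorm ℂ 𝓢(E, ℂ), Continuous q ∧
      ∀ f x, ‖x‖ ^ k * ‖iteratedFDeriv ℝ n (A f) x‖ ≤ q f := by
  induction n with
  | zero => simpa using h.bound k
  | succ n ih =>
    obtain ⟨q, hq, hb⟩ := ih
    let c : ι → NNReal := fun i ↦ ‖ContinuousLinearMap.smulRightL ℝ D ℂ (L i)‖₊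
    refine ⟨∑ i, c i • q.comp (P i).toLinearMap, ?_, fun f x ↦ ?_⟩
    · have : ⇑(∑ i, c i • q.comp (P i).toLinearMap) = fun f ↦ ∑ i, (c i : ℝ) * q (P i f) := by
        ext f
        exact seminorm_sum_apply _ _ f
      rw [this]
      exact continuous_finsetSum _ fun i _ ↦
        continuous_const.mul (hq.comp (P i).continuous)
    · have hs : (∑ i, c i • q.comp (P i).toLinearMap) f = ∑ i, (c i : ℝ) * q (P i f) :=
        seminorm_sum_apply _ _ f
      rw [hs, ← norm_iteratedFDeriv_fderiv, h.fderiv_eq]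
      have hd : ∀ i, ContDiff ℝ n
          (fun x ↦ ContinuousLinearMap.smulRightL ℝ D ℂ (L i) (A (P i f) x)) := fun i ↦
        (ContinuousLinearMap.contDiff _).comp (h.contDiff_nat n (P i f))
      rw [iteratedFDeriv_fun_sum_apply (fun i _ ↦ (hd i).contDiffAt)]
      refine (mul_le_mul_of_nonneg_left (norm_sum_le _ _) (by positivity)).trans ?_
      rw [Finset.mul_sum]
      refine Finset.sum_le_sum fun i _ ↦ ?_
      have h1 := ContinuousLinearMap.norm_iteratedFDeriv_comp_left
        (ContinuousLinearMap.smulRightL ℝ D ℂ (L i)) (f := A (P i f)) (x := x) (n := n)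
        (h.contDiff_nat n (P i f)).contDiffAt le_rfl
      calc _ ≤ ‖x‖ ^ k * (c i * ‖iteratedFDeriv ℝ n (A (P i f)) x‖) :=
            mul_le_mul_of_nonneg_left h1 (by positivity)
        _ = c i * (‖x‖ ^ k * ‖iteratedFDeriv ℝ n (A (P i f)) x‖) := by ring
        _ ≤ _ := mul_le_mul_of_nonneg_left (hb _ _) (NNReal.coe_nonneg _)

/-- The continuous linear map between Schwartz spaces given by `A`. -/
def SchwartzCriterion.toCLM (h : SchwartzCriterion A L P) : 𝓢(E, ℂ) →L[ℂ] 𝓢(D, ℂ) :=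
  SchwartzMap.mkCLM A h.add h.smul h.contDiff <| by
    rintro ⟨k, n⟩
    obtain ⟨q, hq, hb⟩ := h.bound_iterated k n
    obtain ⟨s, C, -, hC⟩ := Seminorm.bound_of_continuous (schwartz_withSeminorms ℂ E ℂ) q hq
    exact ⟨s, C, C.coe_nonneg, fun f x ↦ (hb f x).trans (hC f)⟩

theorem SchwartzCriterion.toCLM_apply (h : SchwartzCriterion A L P) (f : 𝓢(E, ℂ)) (x : D) :
    h.toCLM f x = A f x := rfl

end Criterion

/-! ### Slices -/

/-- The slice `y ↦ Φ (x, y)` of a Schwartz function on `ℝ × ℝ`. -/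
def slice (x : ℝ) : 𝓢(ℝ × ℝ, ℂ) →L[ℂ] 𝓢(ℝ, ℂ) :=
  SchwartzMap.compCLM ℂ (g := fun y : ℝ ↦ (x, y))
    (by
      have h := (Function.HasTemperateGrowth.const (E := ℝ) (x, (0 : ℝ))).add
        (ContinuousLinearMap.inr ℝ ℝ ℝ).hasTemperateGrowth
      convert! h using 2 with y
      simp)
    ⟨1, 1, fun y ↦ by
      have : ‖y‖ ≤ ‖(x, y)‖ := norm_snd_le (x, y)
      rw [one_mul, pow_one]; linarith⟩

@[simp]
theorem slice_apply (x : ℝ) (Φ : 𝓢(ℝ × ℝ, ℂ)) (y : ℝ) : slice x Φ y = Φ (x, y) := rfl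

/-- The partial derivative in the direction `m`. -/
abbrev pd (m : ℝ × ℝ) : 𝓢(ℝ × ℝ, ℂ) →L[ℂ] 𝓢(ℝ × ℝ, ℂ) :=
  LineDeriv.lineDerivOpCLM ℂ 𝓢(ℝ × ℝ, ℂ) m

theorem pd_apply (m : ℝ × ℝ) (Φ : 𝓢(ℝ × ℝ, ℂ)) (z : ℝ × ℝ) :
    pd m Φ z = fderiv ℝ Φ z m := rfl

theorem pd_comm (m m' : ℝ × ℝ) (Φ : 𝓢(ℝ × ℝ, ℂ)) : pd m (pd m' Φ) = pd m' (pd m Φ) := by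
  have key : ∀ (m m' : ℝ × ℝ) z, pd m (pd m' Φ) z = fderiv ℝ (fderiv ℝ Φ) z m m' := by
    intro m m' z
    have h : HasFDerivAt (fderiv ℝ Φ) (fderiv ℝ (fderiv ℝ Φ) z) z :=
      (((Φ.smooth ⊤).fderiv_right (m := ∞) (by simp)).differentiable (by simp) z).hasFDerivAt
    have h' := h.clm_apply (hasFDerivAt_const m' z)
    have h2 : ⇑(pd m' Φ) = fun z ↦ fderiv ℝ Φ z m' := rfl
    rw [pd_apply, h2, h'.fderiv]
    simp
  ext z
  rw [key, key]
  have hs : IsSymmSndFDerivAt ℝ Φ z :=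
    ((Φ.smooth 2).contDiffAt (x := z)).isSymmSndFDerivAt (by simp)
  exact hs.eq m m'

theorem hasDerivAt_slice_left (Φ : 𝓢(ℝ × ℝ, ℂ)) (x y : ℝ) :
    HasDerivAt (fun x ↦ Φ (x, y)) (pd (1, 0) Φ (x, y)) x :=
  (Φ.hasFDerivAt (x, y)).comp_hasDerivAt x ((hasDerivAt_id x).prodMk (hasDerivAt_const x y))

theorem hasDerivAt_slice_right (Φ : 𝓢(ℝ × ℝ, ℂ)) (x y : ℝ) :
    HasDerivAt (fun y ↦ Φ (x, y)) (pd (0, 1) Φ (x, y)) y :=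
  (Φ.hasFDerivAt (x, y)).comp_hasDerivAt y ((hasDerivAt_const y x).prodMk (hasDerivAt_id y))

theorem iteratedDeriv_slice (n : ℕ) (Φ : 𝓢(ℝ × ℝ, ℂ)) (x y : ℝ) :
    iteratedDeriv n (slice x Φ) y = (pd (0, 1) ^ n) Φ (x, y) := by
  induction n generalizing Φ with
  | zero => simp
  | succ n ih =>
    have : deriv (slice x Φ) = slice x (pd (0, 1) Φ) := by
      ext y
      exact (hasDerivAt_slice_right Φ x y).deriv
    rw [iteratedDeriv_succ', this, ih, pow_succ]
    rfl

theorem bound_slice (p : Seminorm ℂ 𝓢(ℝ, ℂ)) (hp : Continuous p) (k : ℕ) :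
    ∃ q : Seminorm ℂ 𝓢(ℝ × ℝ, ℂ), Continuous q ∧
      ∀ Φ x, ‖x‖ ^ k * p (slice x Φ) ≤ q Φ := by
  obtain ⟨s, C, -, hC⟩ := Seminorm.bound_of_continuous (schwartz_withSeminorms ℂ ℝ ℂ) p hp
  have key : ∀ t : Finset (ℕ × ℕ), ∃ q : Seminorm ℂ 𝓢(ℝ × ℝ, ℂ), Continuous q ∧
      ∀ Φ x, ‖x‖ ^ k * (t.sup (schwartzSeminormFamily ℂ ℝ ℂ)) (slice x Φ) ≤ q Φ := by
    intro t
    induction t using Finset.induction_on with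
    | empty => exact ⟨0, continuous_const, fun Φ x ↦ by simp⟩
    | insert a t _ ih =>
      obtain ⟨q, hq, hb⟩ := ih
      let r : Seminorm ℂ 𝓢(ℝ × ℝ, ℂ) :=
        (SchwartzMap.seminorm ℂ (k + a.1) 0).comp (pd (0, 1) ^ a.2).toLinearMap
      have hr : Continuous r :=
        ((schwartz_withSeminorms ℂ (ℝ × ℝ) ℂ).continuous_seminorm (k + a.1, 0)).comp
          (pd (0, 1) ^ a.2).continuous
      refine ⟨r + q, hr.add hq, fun Φ x ↦ ?_⟩
      have h1 : ‖x‖ ^ k * (schwartzSeminormFamily ℂ ℝ ℂ a) (slice x Φ) ≤ r Φ := by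
        by_cases hx : ‖x‖ ^ k = 0
        · rw [hx, zero_mul]; exact apply_nonneg r Φ
        have hx' : 0 < ‖x‖ ^ k := lt_of_le_of_ne (by positivity) (Ne.symm hx)
        rw [← le_div_iff₀' hx']
        refine SchwartzMap.seminorm_le_bound' ℂ a.1 a.2 _
          (div_nonneg (apply_nonneg r Φ) hx'.le) fun y ↦ ?_
        rw [le_div_iff₀' hx', iteratedDeriv_slice]
        have h2 := SchwartzMap.norm_pow_mul_le_seminorm ℂ ((pd (0, 1) ^ a.2) Φ) (k + a.1) (x, y)
        refine le_trans ?_ h2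
        rw [pow_add, mul_assoc]
        have hx1 : ‖x‖ ≤ ‖(x, y)‖ := norm_fst_le (x, y)
        have hy1 : |y| ≤ ‖(x, y)‖ := norm_snd_le (x, y)
        gcongr
      rw [Finset.sup_insert, Seminorm.sup_apply, mul_max_of_nonneg _ _ (by positivity),
        add_apply]
      have h3 := hb Φ x
      have h4 := apply_nonneg r Φ
      have h5 := apply_nonneg q Φ
      exact max_le (by linarith) (by linarith)
  obtain ⟨q, hq, hb⟩ := key s
  refine ⟨C • q, ?_, fun Φ x ↦ ?_⟩
  · exact continuous_const.mul hq
  · calc ‖x‖ ^ k * p (slice x Φ)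
        ≤ ‖x‖ ^ k * (C * (s.sup (schwartzSeminormFamily ℂ ℝ ℂ)) (slice x Φ)) :=
          mul_le_mul_of_nonneg_left (hC _) (by positivity)
      _ = C * (‖x‖ ^ k * (s.sup (schwartzSeminormFamily ℂ ℝ ℂ)) (slice x Φ)) := by ring
      _ ≤ C * q Φ := mul_le_mul_of_nonneg_left (hb Φ x) C.coe_nonneg

theorem taylor_aux (Φ : 𝓢(ℝ × ℝ, ℂ)) (k : ℕ) (x x' y : ℝ) :
    ‖y‖ ^ k * ‖Φ (x', y) - Φ (x, y) - (x' - x : ℝ) • pd (1, 0) Φ (x, y)‖ ≤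
      SchwartzMap.seminorm ℂ k 0 (pd (1, 0) (pd (1, 0) Φ)) * |x' - x| ^ 2 := by
  set M := SchwartzMap.seminorm ℂ k 0 (pd (1, 0) (pd (1, 0) Φ)) with hM
  have hM0 : 0 ≤ M := apply_nonneg _ _
  let c : ℝ := ‖y‖ ^ k
  have hc : 0 ≤ c := by positivity
  have b2 : ∀ z, ‖c • pd (1, 0) (pd (1, 0) Φ) (z, y)‖ ≤ M := by
    intro z
    rw [norm_smul, Real.norm_of_nonneg hc]
    refine le_trans ?_ (SchwartzMap.norm_pow_mul_le_seminorm ℂ _ k (z, y))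
    have : ‖y‖ ≤ ‖(z, y)‖ := norm_snd_le (z, y)
    exact mul_le_mul_of_nonneg_right (pow_le_pow_left₀ (norm_nonneg _) this k) (norm_nonneg _)
  have b1 : ∀ z, ‖c • pd (1, 0) Φ (z, y) - c • pd (1, 0) Φ (x, y)‖ ≤ M * ‖z - x‖ := fun z ↦
    convex_univ.norm_image_sub_le_of_norm_hasDerivWithin_le
      (f := fun z ↦ c • pd (1, 0) Φ (z, y))
      (fun w _ ↦ ((hasDerivAt_slice_left (pd (1, 0) Φ) w y).const_smul c).hasDerivWithinAt)
      (fun w _ ↦ b2 w) (Set.mem_univ x) (Set.mem_univ z)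
  have b0 := (convex_segment x x').norm_image_sub_le_of_norm_hasDerivWithin_le
      (f := fun z ↦ c • Φ (z, y) - z • (c • pd (1, 0) Φ (x, y))) (C := M * |x' - x|)
      (f' := fun z ↦ c • pd (1, 0) Φ (z, y) - (1 : ℝ) • (c • pd (1, 0) Φ (x, y)))
      (fun w _ ↦ (((hasDerivAt_slice_left Φ w y).const_smul c).sub
        ((hasDerivAt_id w).smul_const _)).hasDerivWithinAt)
      (fun w hw ↦ by
        rw [one_smul]
        refine (b1 w).trans (mul_le_mul_of_nonneg_left ?_ hM0)
        rw [← Real.norm_eq_abs]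
        exact norm_sub_le_of_mem_segment hw)
      (left_mem_segment ℝ x x') (right_mem_segment ℝ x x')
  calc _ = ‖(c • Φ (x', y) - x' • (c • pd (1, 0) Φ (x, y)))
          - (c • Φ (x, y) - x • (c • pd (1, 0) Φ (x, y)))‖ := by
        rw [show ‖y‖ ^ k = ‖c‖ from (Real.norm_of_nonneg hc).symm, ← norm_smul]
        congr 1
        simp only [Complex.real_smul]
        push_cast
        ring
    _ ≤ M * |x' - x| * ‖x' - x‖ := b0
    _ = M * |x' - x| ^ 2 := by rw [Real.norm_eq_abs]; ring

theorem taylor_slice (p : Seminorm ℂ 𝓢(ℝ, ℂ)) (hp : Continuous p) (Φ : 𝓢(ℝ × ℝ, ℂ)) :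
    ∃ M : ℝ, ∀ x x', p (slice x' Φ - slice x Φ - ((x' - x : ℝ) : ℂ) • slice x (pd (1, 0) Φ)) ≤
      M * |x' - x| ^ 2 := by
  obtain ⟨s, C, -, hC⟩ := Seminorm.bound_of_continuous (schwartz_withSeminorms ℂ ℝ ℂ) p hp
  let R : ℕ × ℕ → ℝ := fun a ↦
    SchwartzMap.seminorm ℂ a.1 0 (pd (1, 0) (pd (1, 0) ((pd (0, 1) ^ a.2) Φ)))
  have hR : ∀ a, 0 ≤ R a := fun a ↦ apply_nonneg _ _
  refine ⟨C * ∑ a ∈ s, R a, fun x x' ↦ (hC _).trans ?_⟩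
  rw [smul_apply, NNReal.smul_def, smul_eq_mul, mul_assoc]
  refine mul_le_mul_of_nonneg_left ?_ C.coe_nonneg
  refine Seminorm.finset_sup_apply_le
    (mul_nonneg (Finset.sum_nonneg fun a _ ↦ hR a) (by positivity)) fun a ha ↦ ?_
  refine le_trans ?_ (mul_le_mul_of_nonneg_right (Finset.single_le_sum (fun a _ ↦ hR a) ha)
    (by positivity))
  refine SchwartzMap.seminorm_le_bound' ℂ a.1 a.2 _ (mul_nonneg (hR a) (by positivity)) fun y ↦ ?_
  have comm : ∀ n, (pd (0, 1) ^ n) (pd (1, 0) Φ) = pd (1, 0) ((pd (0, 1) ^ n) Φ) := by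
    intro n
    induction n with
    | zero => rfl
    | succ n ih =>
      rw [pow_succ', mul_apply_eq_comp, ih, mul_apply_eq_comp]
      exact pd_comm _ _ _
  have hn : iteratedDeriv a.2
      (slice x' Φ - slice x Φ - ((x' - x : ℝ) : ℂ) • slice x (pd (1, 0) Φ) : 𝓢(ℝ, ℂ)) y =
      ((pd (0, 1) ^ a.2) Φ) (x', y) - ((pd (0, 1) ^ a.2) Φ) (x, y) -
        (x' - x : ℝ) • pd (1, 0) ((pd (0, 1) ^ a.2) Φ) (x, y) := by
    rw [← comm, ← iteratedDeriv_slice, ← iteratedDeriv_slice, ← iteratedDeriv_slice]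
    have e : ∀ f : 𝓢(ℝ, ℂ), ContDiffAt ℝ a.2 f y := fun f ↦ (f.smooth a.2).contDiffAt
    have h1 : ⇑(slice x' Φ - slice x Φ - ((x' - x : ℝ) : ℂ) • slice x (pd (1, 0) Φ) : 𝓢(ℝ, ℂ)) =
      (⇑(slice x' Φ) - ⇑(slice x Φ)) - ((x' - x : ℝ) : ℂ) • ⇑(slice x (pd (1, 0) Φ)) := rfl
    rw [h1, iteratedDeriv_sub (f := ⇑(slice x' Φ) - ⇑(slice x Φ))
      (g := ((x' - x : ℝ) : ℂ) • ⇑(slice x (pd (1, 0) Φ))) ((e _).sub (e _))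
      (e (((x' - x : ℝ) : ℂ) • slice x (pd (1, 0) Φ))), iteratedDeriv_sub (e _) (e _),
      iteratedDeriv_const_smul_field]
    simp
  rw [hn, ← Real.norm_eq_abs y]
  exact taylor_aux _ _ _ _ _

/-! ### Operations on tempered distributions -/

theorem continuous_norm_comp (ν : 𝓢'(ℝ, ℂ)) :
    Continuous ((normSeminorm ℂ ℂ).comp (ν : 𝓢(ℝ, ℂ) →ₗ[ℂ] ℂ)) :=
  continuous_norm.comp (map_continuous ν)

theorem partialApply_criterion (ν : 𝓢'(ℝ, ℂ)) :
    SchwartzCriterion (fun (Φ : 𝓢(ℝ × ℝ, ℂ)) (x : ℝ) ↦ ν (slice x Φ))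
      (fun _ : Unit ↦ ContinuousLinearMap.id ℝ ℝ) (fun _ ↦ pd (1, 0)) where
  add f g x := by simp
  smul a f x := by simp
  deriv f x := by
    obtain ⟨M, hM⟩ := taylor_slice _ (continuous_norm_comp ν) f
    rw [hasFDerivAt_iff_isLittleO]
    refine Asymptotics.IsBigO.trans_isLittleO (g := fun x' ↦ (x' - x) ^ 2) ?_ ?_
    · refine Asymptotics.IsBigO.of_bound M (Filter.Eventually.of_forall fun x' ↦ ?_)
      have := hM x x'
      simp only [Seminorm.comp_apply, coe_normSeminorm] at this
      rw [norm_pow, Real.norm_eq_abs]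
      refine le_trans (le_of_eq ?_) this
      congr 1
      simp [map_sub, map_smul, sub_mul]
    · have := Asymptotics.isLittleO_pow_id (𝕜 := ℝ) (one_lt_two)
      exact this.comp_tendsto (by
        have : Filter.Tendsto (fun x' : ℝ ↦ x' - x) (nhds x) (nhds (x - x)) :=
          (continuous_id.sub continuous_const).tendsto x
        simpa using this)
  bound k := bound_slice _ (continuous_norm_comp ν) k

/-- Application of `ν` in the second variable: `(partialApply ν Φ) x = ⟨ν, Φ (x, ·)⟩`. -/
def partialApply (ν : 𝓢'(ℝ, ℂ)) : 𝓢(ℝ × ℝ, ℂ) →L[ℂ] 𝓢(ℝ, ℂ) := (partialApply_criterion ν).toCLM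

@[simp]
theorem partialApply_apply (ν : 𝓢'(ℝ, ℂ)) (Φ : 𝓢(ℝ × ℝ, ℂ)) (x : ℝ) :
    partialApply ν Φ x = ν (slice x Φ) := rfl

/-- The tensor product `μ ⊗ ν`: `⟨μ ⊗ ν, Φ⟩ = ⟨μ_x, ⟨ν_y, Φ (x, y)⟩⟩`. -/
def tensor (μ ν : 𝓢'(ℝ, ℂ)) : 𝓢'(ℝ × ℝ, ℂ) :=
  PointwiseConvergenceCLM.precomp ℂ (partialApply ν) μ

/-- Complex conjugation of a Schwartz function. -/
def conjS : 𝓢(ℝ, ℂ) →L[ℝ] 𝓢(ℝ, ℂ) :=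
  SchwartzMap.postcompCLM (𝕜 := ℝ) (Complex.conjCLE : ℂ →L[ℝ] ℂ)

@[simp]
theorem conjS_apply (φ : 𝓢(ℝ, ℂ)) (x : ℝ) : conjS φ x = starRingEnd ℂ (φ x) := rfl

/-- The complex conjugate of a tempered distribution, extending `f ↦ conj f`:
`⟨conj ν, φ⟩ = conj ⟨ν, conj φ⟩`. -/
def conjDistribution (ν : 𝓢'(ℝ, ℂ)) : 𝓢'(ℝ, ℂ) :=
  ContinuousLinearMap.toPointwiseConvergenceCLM ℂ (RingHom.id ℂ) 𝓢(ℝ, ℂ) ℂ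
    { toFun := fun φ ↦ starRingEnd ℂ (ν (conjS φ))
      map_add' := fun f g ↦ by simp
      map_smul' := fun a f ↦ by
        have : conjS (a • f) = starRingEnd ℂ a • conjS f := by ext x; simp
        simp [this]
      cont := Complex.continuous_conj.comp ((map_continuous ν).comp conjS.continuous) }

/-- The change of variables `F ↦ F ∘ T`, extended to tempered distributions:
`⟨F ∘ T, Φ⟩ = |det T|⁻¹ ⟨F, Φ ∘ T⁻¹⟩`. -/
def changeVar (T : (ℝ × ℝ) ≃ₗ[ℝ] (ℝ × ℝ)) (u : 𝓢'(ℝ × ℝ, ℂ)) : 𝓢'(ℝ × ℝ, ℂ) :=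
  ((|LinearMap.det (T : (ℝ × ℝ) →ₗ[ℝ] (ℝ × ℝ))|⁻¹ : ℝ) : ℂ) •
    PointwiseConvergenceCLM.precomp ℂ
      (SchwartzMap.compCLMOfContinuousLinearEquiv ℂ T.symm.toContinuousLinearEquiv) u

/-- Multiplication by `-2πi t`, `t` being the second variable. -/
def mulSnd : 𝓢(ℝ × ℝ, ℂ) →L[ℂ] 𝓢(ℝ × ℝ, ℂ) :=
  SchwartzMap.smulLeftCLM ℂ (fun z : ℝ × ℝ ↦ -(2 * Real.pi * Complex.I * (z.2 : ℂ)))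

theorem mulSnd_apply (Φ : 𝓢(ℝ × ℝ, ℂ)) (z : ℝ × ℝ) :
    mulSnd Φ z = -(2 * Real.pi * Complex.I * (z.2 : ℂ)) * Φ z := by
  have : Function.HasTemperateGrowth
      (fun z : ℝ × ℝ ↦ -(2 * Real.pi * Complex.I * (z.2 : ℂ))) := by
    have h : Function.HasTemperateGrowth (fun z : ℝ × ℝ ↦ (z.2 : ℂ)) :=
      (Complex.ofRealCLM.comp (ContinuousLinearMap.snd ℝ ℝ ℝ)).hasTemperateGrowth
    fun_prop
  rw [mulSnd, SchwartzMap.smulLeftCLM_apply_apply this, smul_eq_mul]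

theorem slice_decay (Φ : 𝓢(ℝ × ℝ, ℂ)) :
    ∃ C : ℝ, 0 ≤ C ∧ ∀ x v : ℝ, ‖Φ (x, v)‖ ≤ C * (1 + v ^ 2)⁻¹ := by
  refine ⟨SchwartzMap.seminorm ℂ 0 0 Φ + SchwartzMap.seminorm ℂ 2 0 Φ, by positivity,
    fun x v ↦ ?_⟩
  have h0 := SchwartzMap.norm_pow_mul_le_seminorm ℂ Φ 0 (x, v)
  have h2 := SchwartzMap.norm_pow_mul_le_seminorm ℂ Φ 2 (x, v)
  have hv : v ^ 2 ≤ ‖(x, v)‖ ^ 2 := by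
    rw [← sq_abs]
    exact pow_le_pow_left₀ (abs_nonneg v) (norm_snd_le (x, v)) 2
  rw [← div_eq_mul_inv, le_div_iff₀ (by positivity)]
  have h3 := mul_le_mul_of_nonneg_right hv (norm_nonneg (Φ (x, v)))
  rw [pow_zero, one_mul] at h0
  nlinarith

/-- The integrand of the partial Fourier transform. -/
def fourierIntegrand (Φ : 𝓢(ℝ × ℝ, ℂ)) (z : ℝ × ℝ) (v : ℝ) : ℂ :=
  Complex.exp (((-2 * Real.pi * v * z.2 : ℝ) : ℂ) * Complex.I) * Φ (z.1, v)

theorem norm_fourierIntegrand (Φ : 𝓢(ℝ × ℝ, ℂ)) (z : ℝ × ℝ) (v : ℝ) :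
    ‖fourierIntegrand Φ z v‖ = ‖Φ (z.1, v)‖ := by
  rw [fourierIntegrand, norm_mul, Complex.norm_exp_ofReal_mul_I, one_mul]

theorem continuous_fourierIntegrand (Φ : 𝓢(ℝ × ℝ, ℂ)) (z : ℝ × ℝ) :
    Continuous (fourierIntegrand Φ z) := by
  unfold fourierIntegrand
  have := Φ.continuous
  fun_prop

theorem integrable_fourierIntegrand (Φ : 𝓢(ℝ × ℝ, ℂ)) (z : ℝ × ℝ) :
    Integrable (fourierIntegrand Φ z) := by
  obtain ⟨C, -, hC⟩ := slice_decay Φ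
  refine (integrable_inv_one_add_sq.const_mul C).mono'
    (continuous_fourierIntegrand Φ z).aestronglyMeasurable (Filter.Eventually.of_forall fun v ↦ ?_)
  rw [norm_fourierIntegrand]
  exact hC _ _

theorem fourier_slice_eq (Φ : 𝓢(ℝ × ℝ, ℂ)) (z : ℝ × ℝ) :
    (𝓕 (slice z.1 Φ)) z.2 = ∫ v, fourierIntegrand Φ z v := by
  rw [SchwartzMap.fourier_coe, Real.fourier_real_eq_integral_exp_smul]
  rfl

theorem hasFDerivAt_fourierIntegrand (Φ : 𝓢(ℝ × ℝ, ℂ)) (z : ℝ × ℝ) (v : ℝ) :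
    HasFDerivAt (fun z ↦ fourierIntegrand Φ z v)
      ((ContinuousLinearMap.fst ℝ ℝ ℝ).smulRight (fourierIntegrand (pd (1, 0) Φ) z v) +
        (ContinuousLinearMap.snd ℝ ℝ ℝ).smulRight (fourierIntegrand (mulSnd Φ) z v)) z := by
  have h1 : HasFDerivAt (fun z : ℝ × ℝ ↦ Φ (z.1, v))
      ((ContinuousLinearMap.fst ℝ ℝ ℝ).smulRight (pd (1, 0) Φ (z.1, v))) z :=
    ((hasDerivAt_slice_left Φ z.1 v).hasFDerivAt.comp z hasFDerivAt_fst).congr_fderiv (by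
      ext <;> simp)
  have h2 : HasDerivAt
      (fun w : ℝ ↦ Complex.exp (((-2 * Real.pi * v * w : ℝ) : ℂ) * Complex.I))
      (Complex.exp (((-2 * Real.pi * v * z.2 : ℝ) : ℂ) * Complex.I) *
        (((-2 * Real.pi * v * 1 : ℝ) : ℂ) * Complex.I)) z.2 :=
    ((((hasDerivAt_id z.2).const_mul (-2 * Real.pi * v)).ofReal_comp).mul_const Complex.I).cexp
  have h3 := h2.hasFDerivAt.comp z (hasFDerivAt_snd (𝕜 := ℝ) (E := ℝ) (F := ℝ) (p := z))
  refine (h3.mul h1).congr_fderiv ?_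
  ext
  · simp [fourierIntegrand]
  · simp [fourierIntegrand, mulSnd_apply]
    ring

theorem partialFourier_criterion :
    SchwartzCriterion (fun (Φ : 𝓢(ℝ × ℝ, ℂ)) (z : ℝ × ℝ) ↦ (𝓕 (slice z.1 Φ)) z.2)
      ![ContinuousLinearMap.fst ℝ ℝ ℝ, ContinuousLinearMap.snd ℝ ℝ ℝ]
      ![pd (1, 0), mulSnd] where
  add f g z := by simp [FourierTransform.fourier_add]
  smul a f z := by simp [FourierTransform.fourier_smul]
  deriv Φ z := by
    simp_rw [fourier_slice_eq]
    obtain ⟨C₁, h₁, hC₁⟩ := slice_decay (pd (1, 0) Φ)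
    obtain ⟨C₂, h₂, hC₂⟩ := slice_decay (mulSnd Φ)
    have hd := hasFDerivAt_integral_of_dominated_of_fderiv_le (μ := volume) (𝕜 := ℝ) (x₀ := z)
      (s := Set.univ) (F := fourierIntegrand Φ)
      (F' := fun z v ↦
        (ContinuousLinearMap.fst ℝ ℝ ℝ).smulRight (fourierIntegrand (pd (1, 0) Φ) z v) +
        (ContinuousLinearMap.snd ℝ ℝ ℝ).smulRight (fourierIntegrand (mulSnd Φ) z v))
      (bound := fun v ↦ C₁ * (1 + v ^ 2)⁻¹ + C₂ * (1 + v ^ 2)⁻¹) Filter.univ_mem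
      (Filter.Eventually.of_forall fun z ↦ (continuous_fourierIntegrand Φ z).aestronglyMeasurable)
      (integrable_fourierIntegrand Φ z)
      (by
        have e1 := continuous_fourierIntegrand (pd (1, 0) Φ) z
        have e2 := continuous_fourierIntegrand (mulSnd Φ) z
        exact (((ContinuousLinearMap.smulRightL ℝ (ℝ × ℝ) ℂ
          (ContinuousLinearMap.fst ℝ ℝ ℝ)).continuous.comp e1).add
          ((ContinuousLinearMap.smulRightL ℝ (ℝ × ℝ) ℂ
          (ContinuousLinearMap.snd ℝ ℝ ℝ)).continuous.comp e2)).aestronglyMeasurable)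
      (Filter.Eventually.of_forall fun v z _ ↦ by
        refine (norm_add_le _ _).trans (add_le_add ?_ ?_)
        · rw [ContinuousLinearMap.norm_smulRight_apply, norm_fourierIntegrand]
          refine le_trans ?_ (hC₁ z.1 v)
          exact mul_le_of_le_one_left (norm_nonneg _) (ContinuousLinearMap.norm_fst_le ℝ ℝ ℝ)
        · rw [ContinuousLinearMap.norm_smulRight_apply, norm_fourierIntegrand]
          refine le_trans ?_ (hC₂ z.1 v)
          exact mul_le_of_le_one_left (norm_nonneg _) (ContinuousLinearMap.norm_snd_le ℝ ℝ ℝ))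
      ((integrable_inv_one_add_sq.const_mul C₁).add (integrable_inv_one_add_sq.const_mul C₂))
      (Filter.Eventually.of_forall fun v z _ ↦ hasFDerivAt_fourierIntegrand Φ z v)
    refine hd.congr_fderiv ?_
    have i1 := integrable_fourierIntegrand (pd (1, 0) Φ) z
    have i2 := integrable_fourierIntegrand (mulSnd Φ) z
    have j1 := ContinuousLinearMap.integral_comp_comm
      (ContinuousLinearMap.smulRightL ℝ (ℝ × ℝ) ℂ (ContinuousLinearMap.fst ℝ ℝ ℝ)) i1
    have j2 := ContinuousLinearMap.integral_comp_comm
      (ContinuousLinearMap.smulRightL ℝ (ℝ × ℝ) ℂ (ContinuousLinearMap.snd ℝ ℝ ℝ)) i2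
    have k1 := (ContinuousLinearMap.smulRightL ℝ (ℝ × ℝ) ℂ
      (ContinuousLinearMap.fst ℝ ℝ ℝ)).integrable_comp i1
    have k2 := (ContinuousLinearMap.smulRightL ℝ (ℝ × ℝ) ℂ
      (ContinuousLinearMap.snd ℝ ℝ ℝ)).integrable_comp i2
    refine (integral_add k1 k2).trans ?_
    rw [Fin.sum_univ_two]
    exact congrArg₂ (· + ·) j1 j2
  bound k := by
    let p : ℕ → Seminorm ℂ 𝓢(ℝ, ℂ) := fun j ↦
      (SchwartzMap.seminorm ℂ j 0).comp (SchwartzMap.fourierTransformCLM ℂ).toLinearMap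
    have hp : ∀ j, Continuous (p j) := fun j ↦
      ((schwartz_withSeminorms ℂ ℝ ℂ).continuous_seminorm (j, 0)).comp
        (SchwartzMap.fourierTransformCLM ℂ).continuous
    obtain ⟨q₁, hq₁, hb₁⟩ := bound_slice (p 0) (hp 0) k
    obtain ⟨q₂, hq₂, hb₂⟩ := bound_slice (p k) (hp k) 0
    refine ⟨q₁ + q₂, hq₁.add hq₂, fun Φ z ↦ ?_⟩
    rw [add_apply]
    have e1 : ‖z.1‖ ^ k * ‖(𝓕 (slice z.1 Φ)) z.2‖ ≤ q₁ Φ := by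
      refine le_trans (mul_le_mul_of_nonneg_left ?_ (by positivity)) (hb₁ Φ z.1)
      exact SchwartzMap.norm_le_seminorm ℂ (𝓕 (slice z.1 Φ)) z.2
    have e2 : ‖z.2‖ ^ k * ‖(𝓕 (slice z.1 Φ)) z.2‖ ≤ q₂ Φ := by
      refine le_trans ?_ (hb₂ Φ z.1)
      rw [pow_zero, one_mul]
      exact SchwartzMap.norm_pow_mul_le_seminorm ℂ (𝓕 (slice z.1 Φ)) k z.2
    have h1 := apply_nonneg q₁ Φ
    have h2 := apply_nonneg q₂ Φ
    rw [Prod.norm_def]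
    rcases max_cases ‖z.1‖ ‖z.2‖ with h | h <;> rw [h.1] <;> linarith

/-- The partial Fourier transform of Schwartz functions,
`(F₂ Φ) (x, w) = ∫ Φ (x, t) e^{-2πi w t} dt`. -/
def partialFourier : 𝓢(ℝ × ℝ, ℂ) →L[ℂ] 𝓢(ℝ × ℝ, ℂ) := partialFourier_criterion.toCLM

theorem partialFourier_apply (Φ : 𝓢(ℝ × ℝ, ℂ)) (x w : ℝ) :
    partialFourier Φ (x, w) = (𝓕 (slice x Φ)) w := rfl

/-- The partial Fourier transform in the second variable of tempered distributions, extending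
the one of functions: `⟨F₂ u, Φ⟩ = ⟨u, F₂ Φ⟩` for the bilinear pairing. -/
def partialFourierDistribution (u : 𝓢'(ℝ × ℝ, ℂ)) : 𝓢'(ℝ × ℝ, ℂ) :=
  PointwiseConvergenceCLM.precomp ℂ partialFourier u

/-- The cross matrix-Wigner transform `W_T(μ, ν) = F₂ (T (μ ⊗ conj ν))`. -/
def matrixWigner (T : (ℝ × ℝ) ≃ₗ[ℝ] (ℝ × ℝ)) (μ ν : 𝓢'(ℝ, ℂ)) : 𝓢'(ℝ × ℝ, ℂ) :=
  partialFourierDistribution (changeVar T (tensor μ (conjDistribution ν)))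

/-- A set is uniformly discrete if its distinct points are at distance at least some `δ > 0`. -/
def UniformlyDiscrete {X : Type*} [PseudoMetricSpace X] (S : Set X) : Prop :=
  ∃ δ > 0, ∀ r ∈ S, ∀ s ∈ S, r ≠ s → δ ≤ dist r s

/-- A tempered distribution on `ℝ` is a measure if, on compactly supported test functions, it is
integration against a complex Radon measure, given here by its polar decomposition `h dm` with
`m` a locally finite positive measure and `|h| = 1`. -/
def IsMeasure (u : 𝓢'(ℝ, ℂ)) : Prop :=
  ∃ (m : Measure ℝ) (h : ℝ → ℂ), IsLocallyFiniteMeasure m ∧ Measurable h ∧ (∀ x, ‖h x‖ = 1) ∧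
    ∀ φ : 𝓢(ℝ, ℂ), HasCompactSupport φ → u φ = ∫ x, φ x * h x ∂m

end MatrixWigner

end

namespace MatrixWigner

/-! ### Multiplication by the coordinate and products of test functions -/

/-! Write `w` for the conjugate of `ν`. The partial Fourier transform acts separately on each line
`{x} × ℝ`, so a distribution carried by `A × B` forces `T (μ ⊗ w)` to kill every test function
vanishing on `A × ℝ`. Undoing `T`, the tensor product `μ ⊗ w` kills every test function vanishing on
the parallel lines `a x + b y = r`, `r ∈ A` (`tensor_eq_zero_of_hasSum`).

If the supports of `φ` and `ψ` are so small that their product meets at most the line of index `r`,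
then `(a x + b y - r) φ(x) ψ(y)` is such a function, which gives the bilinear identity
`tensor_relation`. Fix `ψ` with `w ψ ≠ 0` and put `κ = b w(y ψ) / w ψ`. Since `a ≠ 0`, the identity
says that `μ` kills `(x - (r - κ) / a) φ`, so by division by a linear factor (`exists_sub_mul_eq`)
`μ` is locally a multiple of the Dirac mass at `(r - κ) / a`, or zero if that number is not real. As
`κ` does not depend on the place where `μ` is tested, these points lie in an affine image of `A`; a
partition of unity makes the conclusion global (`eq_zero_of_hasCompactSupport_of_relation`). Since
`b ≠ 0`, the same argument with the roles exchanged treats `w`, hence `ν`.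

A distribution killing the compactly supported functions that vanish on a uniformly discrete set is
a locally finite sum of Dirac masses (`isMeasure_of_forall`). -/

theorem hasTemperateGrowth_coord : Function.HasTemperateGrowth (fun x : ℝ ↦ (x : ℂ)) :=
  Complex.ofRealCLM.hasTemperateGrowth

/-- Multiplication by the coordinate. -/
noncomputable def mulCoord : 𝓢(ℝ, ℂ) →L[ℂ] 𝓢(ℝ, ℂ) :=
  SchwartzMap.smulLeftCLM ℂ (fun x : ℝ ↦ (x : ℂ))

@[simp]
theorem mulCoord_apply (φ : 𝓢(ℝ, ℂ)) (x : ℝ) : mulCoord φ x = x * φ x := by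
  rw [mulCoord, SchwartzMap.smulLeftCLM_apply_apply hasTemperateGrowth_coord, smul_eq_mul]

theorem hasCompactSupport_mulCoord {φ : 𝓢(ℝ, ℂ)} (hφ : HasCompactSupport φ) :
    HasCompactSupport (mulCoord φ) := by
  have : ⇑(mulCoord φ) = fun x : ℝ ↦ (x : ℂ) * φ x := funext (mulCoord_apply φ)
  rw [this]
  exact hφ.mul_left

/-- The function `(x, y) ↦ φ x * ψ y` for compactly supported `φ` and `ψ`. -/
noncomputable def prodFun {φ ψ : 𝓢(ℝ, ℂ)} (hφ : HasCompactSupport φ) (hψ : HasCompactSupport ψ) :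
    𝓢(ℝ × ℝ, ℂ) :=
  HasCompactSupport.toSchwartzMap (f := fun z : ℝ × ℝ ↦ φ z.1 * ψ z.2)
    (HasCompactSupport.intro (hφ.isCompact.prod hψ.isCompact) fun z hz ↦ by
      rw [Set.mem_prod, not_and_or] at hz
      rcases hz with hz | hz <;> simp [image_eq_zero_of_notMem_tsupport hz])
    (((φ.smooth ⊤).comp contDiff_fst).mul ((ψ.smooth ⊤).comp contDiff_snd))

@[simp]
theorem prodFun_apply {φ ψ : 𝓢(ℝ, ℂ)} (hφ : HasCompactSupport φ) (hψ : HasCompactSupport ψ)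
    (z : ℝ × ℝ) : prodFun hφ hψ z = φ z.1 * ψ z.2 := rfl

theorem tensor_prodFun (μ ν : 𝓢'(ℝ, ℂ)) {φ ψ : 𝓢(ℝ, ℂ)} (hφ : HasCompactSupport φ)
    (hψ : HasCompactSupport ψ) : tensor μ ν (prodFun hφ hψ) = μ φ * ν ψ := by
  have h : partialApply ν (prodFun hφ hψ) = ν ψ • φ := by
    ext x
    have hs : slice x (prodFun hφ hψ) = φ x • ψ := by
      ext y
      simp
    rw [partialApply_apply, hs, map_smul]
    simp [mul_comm]
  calc tensor μ ν (prodFun hφ hψ) = μ (partialApply ν (prodFun hφ hψ)) := rfl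
    _ = μ φ * ν ψ := by rw [h, map_smul, smul_eq_mul, mul_comm]

/-! ### Inverting the partial Fourier transform -/

theorem slice_partialFourier (Φ : 𝓢(ℝ × ℝ, ℂ)) (x : ℝ) :
    slice x (partialFourier Φ) = 𝓕 (slice x Φ) := by
  ext w
  rw [slice_apply, partialFourier_apply]

theorem partialFourier_partialFourier (Φ : 𝓢(ℝ × ℝ, ℂ)) (x w : ℝ) :
    partialFourier (partialFourier Φ) (x, w) = Φ (x, -w) := by
  rw [partialFourier_apply, slice_partialFourier]
  have h : (𝓕⁻ (𝓕 (slice x Φ))) (-w) = slice x Φ (-w) := by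
    rw [FourierTransform.fourierInv_fourier_eq]
  rw [SchwartzMap.fourierInv_apply_eq] at h
  simpa using h

/-- The square of the partial Fourier transform is the reflection in the second variable, so its
cube is its inverse. Each factor acts slice by slice, hence a zero slice stays zero. -/
theorem exists_partialFourier_eq (Ψ : 𝓢(ℝ × ℝ, ℂ)) :
    ∃ Φ, partialFourier Φ = Ψ ∧ ∀ x, (∀ y, Ψ (x, y) = 0) → ∀ y, Φ (x, y) = 0 := by
  refine ⟨partialFourier (partialFourier (partialFourier Ψ)), ?_, fun x hx y ↦ ?_⟩
  · ext ⟨x, y⟩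
    simp [partialFourier_partialFourier]
  · have : slice x Ψ = 0 := by
      ext y
      exact hx y
    rw [partialFourier_partialFourier, partialFourier_apply, this, FourierTransform.fourier_zero]
    rfl

/-- If the Wigner transform is carried by `A × B`, then `μ ⊗ conj ν` kills the test functions
vanishing on the lines `a u + b v = r`, `r ∈ A`. -/
theorem tensor_eq_zero_of_hasSum {T : (ℝ × ℝ) ≃ₗ[ℝ] (ℝ × ℝ)} {a b c d : ℝ}
    (hT : ∀ u v : ℝ, T.symm (u, v) = (a * u + b * v, c * u + d * v))
    {μ ν : 𝓢'(ℝ, ℂ)} {A B : Set ℝ} {coeff : ℝ × ℝ → ℂ}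
    (hW : HasSum (fun p : (A ×ˢ B : Set (ℝ × ℝ)) ↦
        coeff p • TemperedDistribution.delta (p : ℝ × ℝ)) (matrixWigner T μ ν))
    (Ψ : 𝓢(ℝ × ℝ, ℂ)) (hΨ : ∀ u v, a * u + b * v ∈ A → Ψ (u, v) = 0) :
    tensor μ (conjDistribution ν) Ψ = 0 := by
  -- Pairing the Wigner transform with this `Φ` gives, up to the determinant factor, the pairing of
  -- the tensor product with `Ψ`. The map `T` sends the line `{r} × ℝ` to `a u + b v = r`, where `Ψ`
  -- vanishes for `r ∈ A`; so `Φ` vanishes on `A × ℝ` and every term of the series is zero.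
  obtain ⟨Φ, hΦ, hΦ0⟩ := exists_partialFourier_eq
    (SchwartzMap.compCLMOfContinuousLinearEquiv ℂ T.toContinuousLinearEquiv Ψ)
  have h0 : ∀ z : ℝ × ℝ, z.1 ∈ A → Φ z = 0 := fun z hz ↦ hΦ0 z.1 (fun y ↦ by
    have h1 := hT (T (z.1, y)).1 (T (z.1, y)).2
    rw [Prod.mk.eta, LinearEquiv.symm_apply_apply] at h1
    have h2 := hΨ (T (z.1, y)).1 (T (z.1, y)).2
    rw [show a * (T (z.1, y)).1 + b * (T (z.1, y)).2 = z.1 from (congrArg Prod.fst h1).symm] at h2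
    exact h2 hz) z.2
  have hs : HasSum (fun p : (A ×ˢ B : Set (ℝ × ℝ)) ↦ coeff p • Φ (p : ℝ × ℝ))
      (matrixWigner T μ ν Φ) := by
    refine (hW.map (⟨⟨fun u ↦ u Φ, rfl⟩, fun _ _ ↦ rfl⟩ : 𝓢'(ℝ × ℝ, ℂ) →+ ℂ) ?_)
    exact continuous_eval_const Φ
  have hz : (fun p : (A ×ˢ B : Set (ℝ × ℝ)) ↦ coeff p • Φ (p : ℝ × ℝ)) = fun _ ↦ 0 := by
    ext p
    rw [h0 _ p.2.1, smul_zero]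
  rw [hz] at hs
  have hW0 : matrixWigner T μ ν Φ = 0 := hs.unique hasSum_zero
  have he : SchwartzMap.compCLMOfContinuousLinearEquiv ℂ T.symm.toContinuousLinearEquiv
      (partialFourier Φ) = Ψ := by
    rw [hΦ]
    ext z
    exact congrArg Ψ (T.apply_symm_apply z)
  have hW1 : matrixWigner T μ ν Φ =
      ((|LinearMap.det (T : (ℝ × ℝ) →ₗ[ℝ] (ℝ × ℝ))|⁻¹ : ℝ) : ℂ) •
        tensor μ (conjDistribution ν) Ψ := by
    conv_rhs => rw [← he]
    rfl
  rw [hW0, eq_comm, smul_eq_zero] at hW1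
  refine hW1.resolve_left ?_
  refine Complex.ofReal_ne_zero.2 ?_
  exact inv_ne_zero (abs_ne_zero.2 (LinearEquiv.isUnit_det' T).ne_zero)

/-- Test against `(a x + b y - r) φ(x) ψ(y)`: on each line indexed by `A`, either the product `φ(x)
ψ(y)` or the linear factor is zero. -/
theorem tensor_relation {u w : 𝓢'(ℝ, ℂ)} {a b : ℝ} {A : Set ℝ}
    (h : ∀ Ψ : 𝓢(ℝ × ℝ, ℂ), (∀ x y, a * x + b * y ∈ A → Ψ (x, y) = 0) → tensor u w Ψ = 0)
    {φ ψ : 𝓢(ℝ, ℂ)} (hφ : HasCompactSupport φ) (hψ : HasCompactSupport ψ) {r : ℝ}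
    (hr : ∀ x y, φ x ≠ 0 → ψ y ≠ 0 → a * x + b * y ∈ A → a * x + b * y = r) :
    a * u (mulCoord φ) * w ψ + b * u φ * w (mulCoord ψ) = r * u φ * w ψ := by
  have h1 := h ((a : ℂ) • prodFun (hasCompactSupport_mulCoord hφ) hψ +
    (b : ℂ) • prodFun hφ (hasCompactSupport_mulCoord hψ) - (r : ℂ) • prodFun hφ hψ) (by
      intro x y hxy
      by_cases hx : φ x = 0
      · simp [hx]
      by_cases hy : ψ y = 0
      · simp [hy]
      have := congrArg (fun t : ℝ ↦ (t : ℂ)) (hr x y hx hy hxy)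
      simp only [Complex.ofReal_add, Complex.ofReal_mul] at this
      simp only [sub_apply, add_apply, smul_apply, prodFun_apply, mulCoord_apply, smul_eq_mul]
      linear_combination (φ x * ψ y) * this)
  simp only [map_sub, map_add, map_smul, tensor_prodFun, smul_eq_mul] at h1
  linear_combination h1

/-! ### Division by a linear factor -/

/-- The weighted mean `∫₀¹ t ^ k f (c + t (y - c)) dt`. -/
noncomputable def rayMean (c : ℝ) (k : ℕ) (f : 𝓢(ℝ, ℂ)) (y : ℝ) : ℂ :=
  ∫ t in (0 : ℝ)..1, (t : ℂ) ^ k * f (c + t * (y - c))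

/-- Differentiation under the integral brings out one factor `t`. Allowing all weights `t ^ k`
closes the family under differentiation, so smoothness follows by induction. -/
theorem hasDerivAt_rayMean (c : ℝ) (k : ℕ) (f : 𝓢(ℝ, ℂ)) (y : ℝ) :
    HasDerivAt (rayMean c k f) (rayMean c (k + 1) (SchwartzMap.derivCLM ℂ ℂ f) y) y := by
  have cont : ∀ (k : ℕ) (f : 𝓢(ℝ, ℂ)) (y : ℝ),
      Continuous fun t : ℝ ↦ (t : ℂ) ^ k * f (c + t * (y - c)) := fun k f y ↦ by
    have := f.continuous
    fun_prop
  refine (intervalIntegral.hasDerivAt_integral_of_dominated_loc_of_deriv_le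
    (bound := fun _ ↦ SchwartzMap.seminorm ℂ 0 0 (SchwartzMap.derivCLM ℂ ℂ f))
    (F := fun y (t : ℝ) ↦ (t : ℂ) ^ k * f (c + t * (y - c)))
    (F' := fun y (t : ℝ) ↦ (t : ℂ) ^ (k + 1) * SchwartzMap.derivCLM ℂ ℂ f (c + t * (y - c)))
    Filter.univ_mem
    (Filter.Eventually.of_forall fun z ↦ (cont k f z).aestronglyMeasurable)
    ((cont k f y).intervalIntegrable 0 1) (cont (k + 1) _ y).aestronglyMeasurable
    (Filter.Eventually.of_forall fun t ht z _ ↦ ?_) intervalIntegrable_const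
    (Filter.Eventually.of_forall fun t _ z _ ↦ ?_)).2
  · rw [Set.uIoc_of_le zero_le_one] at ht
    rw [norm_mul, norm_pow, Complex.norm_real, Real.norm_of_nonneg ht.1.le]
    refine (mul_le_of_le_one_left (norm_nonneg _) (pow_le_one₀ ht.1.le ht.2)).trans ?_
    exact SchwartzMap.norm_le_seminorm ℂ _ _
  · have h1 : HasDerivAt (fun z : ℝ ↦ c + t * (z - c)) t z := by
      simpa using (((hasDerivAt_id z).sub_const c).const_mul t).const_add c
    have h2 := ((f.differentiableAt (x := c + t * (z - c))).hasDerivAt.scomp z h1).const_mul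
      ((t : ℂ) ^ k)
    refine h2.congr_deriv ?_
    rw [SchwartzMap.derivCLM_apply, Complex.real_smul]
    ring

theorem contDiff_rayMean (c : ℝ) (k : ℕ) (f : 𝓢(ℝ, ℂ)) : ContDiff ℝ ∞ (rayMean c k f) := by
  refine contDiff_infty.2 fun n ↦ ?_
  induction n generalizing k f with
  | zero =>
    exact contDiff_zero.2 (continuous_iff_continuousAt.2 fun y ↦
      (hasDerivAt_rayMean c k f y).continuousAt)
  | succ n ih =>
    rw [Nat.cast_succ, contDiff_succ_iff_deriv]
    refine ⟨fun y ↦ (hasDerivAt_rayMean c k f y).differentiableAt, by simp, ?_⟩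
    rw [funext fun y ↦ (hasDerivAt_rayMean c k f y).deriv]
    exact ih _ _

/-- Hadamard's lemma: the fundamental theorem of calculus along the segment from `c` to `y`. -/
theorem mul_rayMean (c : ℝ) (f : 𝓢(ℝ, ℂ)) (y : ℝ) :
    ((y - c : ℝ) : ℂ) * rayMean c 0 (SchwartzMap.derivCLM ℂ ℂ f) y = f y - f c := by
  have h := intervalIntegral.integral_eq_sub_of_hasDerivAt (a := (0 : ℝ)) (b := 1)
    (f := fun t : ℝ ↦ f (c + t * (y - c)))
    (f' := fun t : ℝ ↦ ((y - c : ℝ) : ℂ) * ((t : ℂ) ^ 0 *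
      SchwartzMap.derivCLM ℂ ℂ f (c + t * (y - c))))
    (fun t _ ↦ by
      have h1 : HasDerivAt (fun t : ℝ ↦ c + t * (y - c)) (y - c) t := by
        simpa using ((hasDerivAt_id t).mul_const (y - c)).const_add c
      refine ((f.differentiableAt (x := c + t * (y - c))).hasDerivAt.scomp t h1).congr_deriv ?_
      rw [SchwartzMap.derivCLM_apply, Complex.real_smul]
      ring)
    (by
      have := (SchwartzMap.derivCLM ℂ ℂ f).continuous
      exact Continuous.intervalIntegrable (by fun_prop) _ _)
  rw [intervalIntegral.integral_const_mul] at h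
  rw [rayMean, h]
  simp

/-- A test function supported in the compact set `K` and vanishing at `z`, if `z` is real, is
divisible by `x - z`. -/
theorem exists_sub_mul_eq {K : Set ℝ} (hK : IsCompact K) {φ : 𝓢(ℝ, ℂ)} (hφ : ∀ x, φ x ≠ 0 → x ∈ K)
    (z : ℂ) (hz : ∀ x : ℝ, (x : ℂ) = z → φ x = 0) :
    ∃ χ : 𝓢(ℝ, ℂ), (∀ x, χ x ≠ 0 → x ∈ K) ∧ ∀ x : ℝ, (x - z) * χ x = φ x := by
  have key : ∀ g : ℝ → ℂ, ContDiff ℝ ∞ g → (∀ x ∉ K, g x = 0) →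
      (∀ x : ℝ, (x - z) * g x = φ x) →
      ∃ χ : 𝓢(ℝ, ℂ), (∀ x, χ x ≠ 0 → x ∈ K) ∧ ∀ x : ℝ, (x - z) * χ x = φ x :=
    fun g hg h0 h1 ↦ ⟨(HasCompactSupport.intro hK h0).toSchwartzMap hg,
      fun x hx ↦ by_contra fun h ↦ hx (h0 x h), h1⟩
  have hφ' : ∀ x ∉ K, φ x = 0 := fun x hx ↦ by_contra fun h ↦ hx (hφ x h)
  by_cases hr : ∃ c : ℝ, (c : ℂ) = z
  · obtain ⟨c, rfl⟩ := hr
    have hm : ∀ x : ℝ, ((x : ℂ) - c) * rayMean c 0 (SchwartzMap.derivCLM ℂ ℂ φ) x = φ x := by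
      intro x
      have := mul_rayMean c φ x
      rwa [hz c rfl, sub_zero, Complex.ofReal_sub] at this
    refine key _ (contDiff_rayMean c 0 (SchwartzMap.derivCLM ℂ ℂ φ)) (fun x hx ↦ ?_) hm
    -- Outside `K` the quotient is zero by cancellation, except possibly at `x = c`. There it equals
    -- `φ' c`, which is zero because `φ` vanishes on the open complement of `K`.
    have hc := hm x
    rw [hφ' x hx, mul_eq_zero, sub_eq_zero, Complex.ofReal_inj] at hc
    rcases hc with rfl | hc
    · have hd : deriv φ x = 0 := by
        have : φ =ᶠ[nhds x] fun _ ↦ 0 :=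
          Filter.eventually_of_mem (hK.isClosed.isOpen_compl.mem_nhds hx) hφ'
        rw [this.deriv_eq, deriv_const]
      simp [rayMean, hd]
    · exact hc
  · have hne : ∀ x : ℝ, (x : ℂ) - z ≠ 0 := fun x h ↦ hr ⟨x, sub_eq_zero.1 h⟩
    refine key (fun x ↦ ((x : ℂ) - z)⁻¹ * φ x) ?_ (fun x hx ↦ by rw [hφ' x hx, mul_zero])
      fun x ↦ mul_inv_cancel_left₀ (hne x) _
    exact ((Complex.ofRealCLM.contDiff.sub contDiff_const).inv hne).mul (φ.smooth ⊤)

/-! ### Cut-offs and localization -/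

/-- A compactly supported function equal to `1` on `[-1, 1]`. -/
noncomputable def cutoff : 𝓢(ℝ, ℂ) :=
  HasCompactSupport.toSchwartzMap (f := fun t : ℝ ↦ (Real.smoothTransition (2 - t ^ 2) : ℂ))
    (HasCompactSupport.intro (isCompact_Icc (a := (-2 : ℝ)) (b := 2)) fun t ht ↦ by
      rw [Real.smoothTransition.zero_of_nonpos, Complex.ofReal_zero]
      by_contra h
      exact ht ⟨by nlinarith, by nlinarith⟩)
    (Complex.ofRealCLM.contDiff.comp (Real.smoothTransition.contDiff.comp (by fun_prop)))

theorem cutoff_eq_one {t : ℝ} (ht : |t| ≤ 1) : cutoff t = 1 := by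
  have h : t ^ 2 ≤ 1 := by rw [← sq_abs]; exact pow_le_one₀ (abs_nonneg t) ht
  change ((Real.smoothTransition (2 - t ^ 2) : ℝ) : ℂ) = 1
  rw [Real.smoothTransition.one_of_one_le (by linarith), Complex.ofReal_one]

theorem cutoff_eq_zero {t : ℝ} (ht : 2 ≤ |t|) : cutoff t = 0 := by
  have h : (2 : ℝ) ^ 2 ≤ t ^ 2 := by rw [← sq_abs t]; gcongr
  change ((Real.smoothTransition (2 - t ^ 2) : ℝ) : ℂ) = 0
  rw [Real.smoothTransition.zero_of_nonpos (by linarith), Complex.ofReal_zero]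

/-- For `i = 0` the difference vanishes unless `1 < ε |x|`, so a constant bound can be multiplied by
`ε (1 + |x|)`. For `i > 0` the chain rule supplies `ε ^ i ≤ ε`. -/
theorem exists_iteratedDeriv_cutoff_le (i : ℕ) :
    ∃ C : ℝ, 0 ≤ C ∧ ∀ ε : ℝ, 0 < ε → ε ≤ 1 → ∀ x : ℝ,
      ‖iteratedDeriv i (fun x ↦ cutoff (ε * x) - 1) x‖ ≤ ε * (C * (1 + |x|)) := by
  cases i with
  | zero =>
    refine ⟨SchwartzMap.seminorm ℂ 0 0 cutoff + 1, by positivity, fun ε h0 _ x ↦ ?_⟩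
    rw [iteratedDeriv_zero]
    have h1 : 0 ≤ SchwartzMap.seminorm ℂ 0 0 cutoff + 1 := by positivity
    rcases le_or_gt |ε * x| 1 with h | h
    · rw [cutoff_eq_one h, sub_self, norm_zero]
      positivity
    · have h2 : ‖cutoff (ε * x) - 1‖ ≤ SchwartzMap.seminorm ℂ 0 0 cutoff + 1 := by
        refine (norm_sub_le _ _).trans ?_
        rw [norm_one]
        gcongr
        exact SchwartzMap.norm_le_seminorm ℂ _ _
      rw [abs_mul, abs_of_pos h0] at h
      calc _ ≤ (SchwartzMap.seminorm ℂ 0 0 cutoff + 1) * 1 := by rwa [mul_one]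
        _ ≤ (SchwartzMap.seminorm ℂ 0 0 cutoff + 1) * (ε * (1 + |x|)) :=
          mul_le_mul_of_nonneg_left (by nlinarith) h1
        _ = _ := by ring
  | succ i =>
    refine ⟨SchwartzMap.seminorm ℂ 0 (i + 1) cutoff, by positivity, fun ε h0 h1 x ↦ ?_⟩
    have hd : iteratedDeriv (i + 1) (fun x ↦ cutoff (ε * x) - 1) =
        iteratedDeriv (i + 1) (fun x ↦ cutoff (ε * x)) := by
      rw [iteratedDeriv_succ', iteratedDeriv_succ']
      congr 1
      ext x
      exact deriv_sub_const _
    rw [hd, iteratedDeriv_comp_const_smul (cutoff.smooth (i + 1 : ℕ)) ε]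
    rw [norm_smul, norm_pow, Real.norm_of_nonneg h0.le]
    have h2 := SchwartzMap.le_seminorm ℂ 0 (i + 1) cutoff (ε * x)
    rw [pow_zero, one_mul, norm_iteratedFDeriv_eq_norm_iteratedDeriv] at h2
    refine mul_le_mul (pow_le_of_le_one h0.le h1 (by simp)) (h2.trans ?_) (norm_nonneg _) h0.le
    exact le_mul_of_one_le_right (by positivity) (by linarith [abs_nonneg x])

/-- The truncation `x ↦ cutoff (ε x) φ x`. -/
noncomputable def truncate (ε : ℝ) (φ : 𝓢(ℝ, ℂ)) : 𝓢(ℝ, ℂ) :=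
  SchwartzMap.smulLeftCLM ℂ (fun x : ℝ ↦ cutoff (ε * x)) φ

theorem truncate_apply (ε : ℝ) (φ : 𝓢(ℝ, ℂ)) (x : ℝ) :
    truncate ε φ x = cutoff (ε * x) * φ x := by
  have h : Function.HasTemperateGrowth fun x : ℝ ↦ cutoff (ε * x) :=
    cutoff.hasTemperateGrowth.comp (g := cutoff)
      ((ε • ContinuousLinearMap.id ℝ ℝ).hasTemperateGrowth)
  rw [truncate, SchwartzMap.smulLeftCLM_apply_apply h, smul_eq_mul]

theorem hasCompactSupport_truncate {ε : ℝ} (hε : 0 < ε) (φ : 𝓢(ℝ, ℂ)) :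
    HasCompactSupport (truncate ε φ) := by
  refine HasCompactSupport.intro (isCompact_Icc (a := -(2 / ε)) (b := 2 / ε)) fun x hx ↦ ?_
  rw [truncate_apply, cutoff_eq_zero, zero_mul]
  by_contra h
  push Not at h
  refine hx (abs_le.1 ?_)
  rw [abs_mul, abs_of_pos hε] at h
  rw [le_div_iff₀ hε]
  linarith

/-- By the Leibniz rule each seminorm of the error is `O(ε)`; the growth `1 + |x|` of the cut-off
bound is absorbed by a seminorm of `φ` with one more power of `x`. -/
theorem tendsto_truncate (φ : 𝓢(ℝ, ℂ)) :
    Filter.Tendsto (fun ε ↦ truncate ε φ) (nhdsWithin 0 (Set.Ioi 0)) (nhds φ) := by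
  rw [(schwartz_withSeminorms ℂ ℝ ℂ).tendsto_nhds]
  rintro ⟨k, n⟩ η hη
  choose C hC0 hC using exists_iteratedDeriv_cutoff_le
  set M : ℝ := ∑ i ∈ Finset.range (n + 1), (n.choose i : ℝ) * C i *
    (SchwartzMap.seminorm ℂ k (n - i) φ + SchwartzMap.seminorm ℂ (k + 1) (n - i) φ) with hM
  have hM0 : 0 ≤ M := Finset.sum_nonneg fun i _ ↦
    mul_nonneg (mul_nonneg (by positivity) (hC0 i)) (by positivity)
  have hb : ∀ ε : ℝ, 0 < ε → ε ≤ 1 →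
      SchwartzMap.seminorm ℂ k n (truncate ε φ - φ) ≤ ε * M := by
    intro ε h0 h1
    refine SchwartzMap.seminorm_le_bound' ℂ k n _ (mul_nonneg h0.le hM0) fun x ↦ ?_
    have he : ⇑(truncate ε φ - φ) = (fun x ↦ cutoff (ε * x) - 1) * ⇑φ := by
      ext x
      simp [truncate_apply, sub_mul]
    have hs : ContDiff ℝ n fun x : ℝ ↦ cutoff (ε * x) - 1 :=
      ((cutoff.smooth n).comp (contDiff_const.mul contDiff_id)).sub contDiff_const
    rw [he, iteratedDeriv_mul hs.contDiffAt (φ.smooth n).contDiffAt, hM, Finset.mul_sum]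
    refine (mul_le_mul_of_nonneg_left (norm_sum_le _ _) (by positivity)).trans ?_
    rw [Finset.mul_sum]
    refine Finset.sum_le_sum fun i _ ↦ ?_
    have e1 := SchwartzMap.le_seminorm' ℂ k (n - i) φ x
    have e2 := SchwartzMap.le_seminorm' ℂ (k + 1) (n - i) φ x
    rw [norm_mul, norm_mul, Complex.norm_natCast]
    calc |x| ^ k * (n.choose i * ‖iteratedDeriv i (fun x ↦ cutoff (ε * x) - 1) x‖ *
          ‖iteratedDeriv (n - i) φ x‖)
        ≤ |x| ^ k * (n.choose i * (ε * (C i * (1 + |x|))) * ‖iteratedDeriv (n - i) φ x‖) := by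
          gcongr
          exact hC i ε h0 h1 x
      _ = ε * (n.choose i * C i * (|x| ^ k * ‖iteratedDeriv (n - i) φ x‖ +
            |x| ^ (k + 1) * ‖iteratedDeriv (n - i) φ x‖)) := by ring
      _ ≤ _ := by
          have := hC0 i
          gcongr
  have hlim : Filter.Tendsto (fun ε : ℝ ↦ ε * M) (nhdsWithin 0 (Set.Ioi 0)) (nhds 0) := by
    have : Filter.Tendsto (fun ε : ℝ ↦ ε * M) (nhds 0) (nhds (0 * M)) :=
      (continuous_id.mul continuous_const).tendsto 0
    rw [zero_mul] at this
    exact this.mono_left nhdsWithin_le_nhds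
  filter_upwards [hlim.eventually_lt_const hη, self_mem_nhdsWithin,
    mem_nhdsWithin_of_mem_nhds (Iic_mem_nhds (zero_lt_one' ℝ))] with ε h1 h2 h3
  exact (hb ε h2 h3).trans_lt h1

theorem eq_zero_of_forall_hasCompactSupport {u : 𝓢'(ℝ, ℂ)}
    (h : ∀ φ : 𝓢(ℝ, ℂ), HasCompactSupport φ → u φ = 0) : u = 0 := by
  ext φ
  have h1 := ((map_continuous u).tendsto φ).comp (tendsto_truncate φ)
  refine tendsto_nhds_unique h1 (Filter.Tendsto.congr' ?_ tendsto_const_nhds)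
  filter_upwards [self_mem_nhdsWithin] with ε hε
  exact (h _ (hasCompactSupport_truncate hε φ)).symm

/-- The elements of a smooth partition of unity with supports of length `2ρ`. -/
noncomputable def bumpPiece (ρ c x : ℝ) : ℝ :=
  Real.smoothTransition ((x - c) / ρ + 1) - Real.smoothTransition ((x - c) / ρ)

theorem bumpPiece_eq_zero {ρ c x : ℝ} (hρ : 0 < ρ) (hx : ρ < |x - c|) : bumpPiece ρ c x = 0 := by
  rcases lt_abs.1 hx with h | h
  · have : 1 < (x - c) / ρ := (one_lt_div hρ).2 h
    rw [bumpPiece, Real.smoothTransition.one_of_one_le (by linarith),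
      Real.smoothTransition.one_of_one_le this.le, sub_self]
  · have : (x - c) / ρ < -1 := by
      rw [div_lt_iff₀ hρ]
      linarith
    rw [bumpPiece, Real.smoothTransition.zero_of_nonpos (by linarith),
      Real.smoothTransition.zero_of_nonpos (by linarith), sub_self]

theorem hasTemperateGrowth_bumpPiece {ρ : ℝ} (hρ : 0 < ρ) (c : ℝ) :
    Function.HasTemperateGrowth fun x : ℝ ↦ (bumpPiece ρ c x : ℂ) := by
  refine HasCompactSupport.hasTemperateGrowth
    (HasCompactSupport.intro (isCompact_closedBall c ρ) fun x hx ↦ ?_) ?_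
  · rw [bumpPiece_eq_zero hρ, Complex.ofReal_zero]
    rwa [Metric.mem_closedBall, not_le, Real.dist_eq] at hx
  · refine Complex.ofRealCLM.contDiff.comp (g := Complex.ofRealCLM) (f := bumpPiece ρ c) ?_
    unfold bumpPiece
    exact (Real.smoothTransition.contDiff.comp (by fun_prop)).sub
      (Real.smoothTransition.contDiff.comp (by fun_prop))

/-- The pieces are differences of consecutive translates by `ρ` of one smooth step, so the sum
telescopes. With `2 N + 1` pieces the two remaining arguments are `≥ 1` and `≤ 0` on the whole range
of `x`. -/
theorem sum_bumpPiece {ρ : ℝ} (hρ : 0 < ρ) {N : ℕ} {x : ℝ} (hx : |x| ≤ N * ρ) :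
    ∑ n ∈ Finset.range (2 * N + 1), bumpPiece ρ ((n - N : ℝ) * ρ) x = 1 := by
  have hx' : |x / ρ| ≤ N := by rwa [abs_div, abs_of_pos hρ, div_le_iff₀ hρ]
  have h : ∀ n : ℕ, bumpPiece ρ ((n - N : ℝ) * ρ) x =
      Real.smoothTransition (x / ρ + N + 1 - n) -
        Real.smoothTransition (x / ρ + N + 1 - (n + 1 : ℕ)) := by
    intro n
    have : (x - (n - N : ℝ) * ρ) / ρ = x / ρ - (n - N) := by field_simp
    rw [bumpPiece, this]
    push_cast
    congr 2 <;> ring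
  simp_rw [h]
  rw [Finset.sum_range_sub' (fun n : ℕ ↦ Real.smoothTransition (x / ρ + N + 1 - n))]
  have := abs_le.1 hx'
  rw [Real.smoothTransition.one_of_one_le (by push_cast; linarith),
    Real.smoothTransition.zero_of_nonpos (by push_cast; linarith), sub_zero]

/-- Multiplying by the pieces of the partition of unity keeps the zeros of `φ` on `S`, and finitely
many pieces suffice on a compact support. -/
theorem eq_zero_of_forall_local {u : 𝓢'(ℝ, ℂ)} {S : Set ℝ} {ρ : ℝ} (hρ : 0 < ρ)
    (h : ∀ (c : ℝ) (φ : 𝓢(ℝ, ℂ)), (∀ x, φ x ≠ 0 → x ∈ Metric.closedBall c ρ) →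
      (∀ s ∈ S, φ s = 0) → u φ = 0) {φ : 𝓢(ℝ, ℂ)} (hφ : HasCompactSupport φ)
    (hS : ∀ s ∈ S, φ s = 0) : u φ = 0 := by
  obtain ⟨R, hR⟩ := hφ.isCompact.isBounded.exists_norm_le
  obtain ⟨N, hN⟩ := exists_nat_ge (R / ρ)
  rw [div_le_iff₀ hρ] at hN
  let P : ℕ → 𝓢(ℝ, ℂ) := fun n ↦
    SchwartzMap.smulLeftCLM ℂ (fun x : ℝ ↦ (bumpPiece ρ ((n - N : ℝ) * ρ) x : ℂ)) φ
  have hP : ∀ n x, P n x = bumpPiece ρ ((n - N : ℝ) * ρ) x * φ x := fun n x ↦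
    SchwartzMap.smulLeftCLM_apply_apply (hasTemperateGrowth_bumpPiece hρ _) _ _
  have hsum : φ = ∑ n ∈ Finset.range (2 * N + 1), P n := by
    ext x
    rw [sum_apply]
    simp_rw [hP]
    rw [← Finset.sum_mul, ← Complex.ofReal_sum]
    by_cases hx : φ x = 0
    · rw [hx, mul_zero]
    · rw [sum_bumpPiece hρ ((hR x (subset_tsupport _ hx)).trans hN), Complex.ofReal_one, one_mul]
  rw [hsum, map_sum]
  refine Finset.sum_eq_zero fun n _ ↦ h ((n - N : ℝ) * ρ) _ (fun x hx ↦ ?_) fun s hs ↦ ?_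
  · by_contra hc
    rw [Metric.mem_closedBall, not_le, Real.dist_eq] at hc
    rw [hP, bumpPiece_eq_zero hρ hc] at hx
    simp at hx
  · rw [hP, hS s hs, mul_zero]

theorem exists_local_ne_zero {u : 𝓢'(ℝ, ℂ)} (hu : u ≠ 0) {ρ : ℝ} (hρ : 0 < ρ) :
    ∃ (c : ℝ) (φ : 𝓢(ℝ, ℂ)), (∀ x, φ x ≠ 0 → x ∈ Metric.closedBall c ρ) ∧ u φ ≠ 0 := by
  by_contra! h
  exact hu (eq_zero_of_forall_hasCompactSupport fun φ hφ ↦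
    eq_zero_of_forall_local (S := ∅) hρ (fun c φ h1 _ ↦ h c φ h1) hφ (by simp))

/-! ### Discrete support from the tensor relation -/

/-- Freezing `ψ` turns the bilinear relation into a linear equation `(x - z) u = 0` near each point.
The hypothesis is symmetric under exchanging `(u, a)` and `(w, b)`, so the lemma serves both
factors. -/
theorem eq_zero_of_hasCompactSupport_of_relation {u w : 𝓢'(ℝ, ℂ)} (hw : w ≠ 0) {a b : ℝ}
    (ha : a ≠ 0) (hb : b ≠ 0) {A : Set ℝ} (hA : UniformlyDiscrete A)
    (hrel : ∀ φ ψ : 𝓢(ℝ, ℂ), HasCompactSupport φ → HasCompactSupport ψ → ∀ r : ℝ,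
      (∀ x y, φ x ≠ 0 → ψ y ≠ 0 → a * x + b * y ∈ A → a * x + b * y = r) →
      a * u (mulCoord φ) * w ψ + b * u φ * w (mulCoord ψ) = r * u φ * w ψ) :
    ∃ S : Set ℝ, UniformlyDiscrete S ∧
      ∀ φ : 𝓢(ℝ, ℂ), HasCompactSupport φ → (∀ s ∈ S, φ s = 0) → u φ = 0 := by
  obtain ⟨δ, hδ, hA⟩ := hA
  have ha' : 0 < |a| := abs_pos.2 ha
  have hb' : 0 < |b| := abs_pos.2 hb
  -- With radii `δ / (5 |b|)` here and `δ / (5 |a|)` for `φ`, the form `a x + b y` stays within `2 δ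
  -- / 5` of its central value. Two elements of `A` that close to it differ by at most `4 δ / 5 <
  -- δ`, so they coincide.
  obtain ⟨v, ψ, hψ, hwψ⟩ := exists_local_ne_zero hw (ρ := δ / (5 * |b|)) (by positivity)
  have cs : ∀ {φ : 𝓢(ℝ, ℂ)} {c ρ : ℝ}, (∀ x, φ x ≠ 0 → x ∈ Metric.closedBall c ρ) →
      HasCompactSupport φ := fun {φ c ρ} h ↦
    HasCompactSupport.intro (isCompact_closedBall c ρ) fun x hx ↦ by_contra fun h' ↦ hx (h x h')
  have haC : (a : ℂ) ≠ 0 := Complex.ofReal_ne_zero.2 ha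
  let κ : ℂ := b * w (mulCoord ψ) / w ψ
  -- A priori `κ` is complex. Taking the real part loses nothing: division by `x - (r - κ) / a`
  -- needs a zero of `φ` only when this root is real, and then the root is `(r - κ.re) / a`.
  refine ⟨(fun r ↦ (r - κ.re) / a) '' A, ⟨δ / |a|, by positivity, ?_⟩, fun φ hφ hφS ↦
    eq_zero_of_forall_local (ρ := δ / (5 * |a|)) (by positivity) (fun c φ hφ hφS ↦ ?_) hφ hφS⟩
  · rintro _ ⟨r, hr, rfl⟩ _ ⟨s, hs, rfl⟩ hne
    have hrs : r ≠ s := fun h ↦ hne (by rw [h])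
    rw [Real.dist_eq, ← sub_div, sub_sub_sub_cancel_right, abs_div]
    gcongr
    exact hA r hr s hs hrs
  · have near : ∀ (χ : 𝓢(ℝ, ℂ)), (∀ x, χ x ≠ 0 → x ∈ Metric.closedBall c (δ / (5 * |a|))) →
        ∀ x y, χ x ≠ 0 → ψ y ≠ 0 → |a * x + b * y - (a * c + b * v)| ≤ 2 * δ / 5 := by
      intro χ hχ x y hx hy
      have h1 := hχ x hx
      have h2 := hψ y hy
      rw [Metric.mem_closedBall, Real.dist_eq, le_div_iff₀ (by positivity)] at h1 h2
      have h3 : |a * (x - c)| ≤ δ / 5 := by rw [abs_mul]; linarith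
      have h4 : |b * (y - v)| ≤ δ / 5 := by rw [abs_mul]; linarith
      calc _ = |a * (x - c) + b * (y - v)| := by congr 1; ring
        _ ≤ _ := (abs_add_le _ _).trans (by linarith)
    by_cases hr : ∃ r ∈ A, |r - (a * c + b * v)| ≤ 2 * δ / 5
    · obtain ⟨r, hrA, hr⟩ := hr
      obtain ⟨χ, hχ, hχφ⟩ := exists_sub_mul_eq (isCompact_closedBall c _) hφ ((r - κ) / a)
        (fun x hx ↦ hφS x ⟨r, hrA, by
          have := congrArg Complex.re hx
          rw [Complex.ofReal_re, Complex.div_ofReal_re, Complex.sub_re, Complex.ofReal_re] at this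
          exact this.symm⟩)
      have h1 := hrel χ ψ (cs hχ) (cs hψ) r (fun x y hx hy hxy ↦ by
        by_contra hne
        have h2 := hA _ hxy r hrA hne
        have h3 := near χ hχ x y hx hy
        rw [Real.dist_eq] at h2
        rw [abs_le] at h3 hr
        rcases le_abs.1 h2 with h | h <;> linarith)
      have hφe : φ = mulCoord χ - (((r : ℂ) - κ) / a) • χ := by
        ext x
        simp [← hχφ, sub_mul]
      have hκ : κ * w ψ = b * w (mulCoord ψ) := div_mul_cancel₀ _ hwψ
      rw [hφe, map_sub, map_smul, smul_eq_mul]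
      refine (mul_eq_zero.1 (?_ : (a * w ψ) * _ = 0)).resolve_left (mul_ne_zero haC hwψ)
      field_simp
      linear_combination h1 + u χ * hκ
    -- No line of `A` meets the supports, so the relation holds for every `r`; subtracting the cases
    -- `0` and `1` leaves `u φ * w ψ = 0`.
    · push Not at hr
      have h1 : ∀ r : ℝ, _ := fun r ↦ hrel φ ψ (cs hφ) (cs hψ) r (fun x y hx hy hxy ↦
        absurd (near φ hφ x y hx hy) (not_le.2 (hr _ hxy)))
      have h2 := h1 0
      have h3 := h1 1
      rw [Complex.ofReal_zero] at h2
      rw [Complex.ofReal_one] at h3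
      have h4 : u φ * w ψ = 0 := by linear_combination h2 - h3
      exact (mul_eq_zero.1 h4).resolve_right hwψ

/-! ### Distributions killed by the functions vanishing on a discrete set -/

/-- At most one point of `S` lies within `δ / 2` of `x`; if it is not `x` itself, its distance to
`x` is a valid radius. -/
theorem UniformlyDiscrete.exists_ball {S : Set ℝ} (hS : UniformlyDiscrete S) (x : ℝ) :
    ∃ ε > 0, ∀ s ∈ S, dist s x < ε → s = x := by
  obtain ⟨δ, hδ, hS⟩ := hS
  by_cases h : ∃ s ∈ S, dist s x < δ / 2 ∧ s ≠ x
  · obtain ⟨s, hs, hsx, hne⟩ := h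
    refine ⟨dist s x, dist_pos.2 hne, fun t ht htx ↦ ?_⟩
    by_contra
    have hts : t ≠ s := fun h ↦ htx.ne (by rw [h])
    have h1 := hS t ht s hs hts
    have h2 := dist_triangle_right t s x
    linarith
  · push Not at h
    exact ⟨δ / 2, by positivity, h⟩

theorem UniformlyDiscrete.finite_inter {S : Set ℝ} (hS : UniformlyDiscrete S) {K : Set ℝ}
    (hK : IsCompact K) : (S ∩ K).Finite := by
  refine hK.induction_on (p := fun K ↦ (S ∩ K).Finite) (by simp)
    (fun s t hst ht ↦ ht.subset (Set.inter_subset_inter_right S hst))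
    (fun s t hs ht ↦ by rw [Set.inter_union_distrib_left]; exact hs.union ht) fun x _ ↦ ?_
  obtain ⟨ε, hε, h⟩ := hS.exists_ball x
  exact ⟨Metric.ball x ε, mem_nhdsWithin_of_mem_nhds (Metric.ball_mem_nhds x hε),
    (Set.finite_singleton x).subset fun s hs ↦ h s hs.1 hs.2⟩

theorem UniformlyDiscrete.countable {S : Set ℝ} (hS : UniformlyDiscrete S) : S.Countable := by
  have : S = ⋃ n : ℕ, S ∩ Metric.closedBall 0 n := by
    rw [← Set.inter_iUnion, Metric.iUnion_closedBall_nat, Set.inter_univ]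
  rw [this]
  exact Set.countable_iUnion fun n ↦ (hS.finite_inter (isCompact_closedBall _ _)).countable

theorem UniformlyDiscrete.exists_interpolation {S : Set ℝ} (hS : UniformlyDiscrete S) :
    ∃ χ : ℝ → 𝓢(ℝ, ℂ), (∀ s, HasCompactSupport (χ s)) ∧ (∀ s, χ s s = 1) ∧
      ∀ s ∈ S, ∀ t ∈ S, t ≠ s → χ s t = 0 := by
  obtain ⟨δ, hδ, hS⟩ := hS
  have hz : ∀ s x : ℝ, δ ≤ dist x s → cutoff (2 * (x - s) / δ) = 0 := fun s x h ↦ by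
    rw [Real.dist_eq] at h
    apply cutoff_eq_zero
    rw [abs_div, abs_mul, abs_of_pos hδ, abs_of_pos (zero_lt_two' ℝ), le_div_iff₀ hδ]
    linarith
  have hc : ∀ s : ℝ, HasCompactSupport fun x : ℝ ↦ cutoff (2 * (x - s) / δ) := fun s ↦
    HasCompactSupport.intro (isCompact_closedBall s δ) fun x hx ↦ hz s x
      (not_le.1 fun h ↦ hx (Metric.mem_closedBall.2 h)).le
  refine ⟨fun s ↦ (hc s).toSchwartzMap ((cutoff.smooth ⊤).comp (by fun_prop)), hc, fun s ↦ ?_,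
    fun s hs t ht hts ↦ hz s t (hS t ht s hs hts)⟩
  change cutoff (2 * (s - s) / δ) = 1
  exact cutoff_eq_one (by simp)

theorem dsupport_subset_of_forall {u : 𝓢'(ℝ, ℂ)} {S : Set ℝ} (hS : UniformlyDiscrete S)
    (h : ∀ φ : 𝓢(ℝ, ℂ), HasCompactSupport φ → (∀ s ∈ S, φ s = 0) → u φ = 0) :
    Distribution.dsupport u ⊆ S := by
  intro x hx
  by_contra hxS
  obtain ⟨ε, hε, hb⟩ := hS.exists_ball x
  refine (Distribution.notMem_dsupport_iff x).2 ⟨Metric.ball x ε, fun φ hφ ↦ h φ ?_ fun s hs ↦ ?_,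
    Metric.isOpen_ball, Metric.mem_ball_self hε⟩ hx
  · exact (isCompact_closedBall x ε).of_isClosed_subset (isClosed_tsupport _)
      (hφ.trans Metric.ball_subset_closedBall)
  · by_contra hne
    exact hxS (hb s hs (hφ (subset_tsupport _ hne)) ▸ hs)

/-- With `χ s` equal to `1` at `s` and `0` on the rest of `S`, the function `φ - ∑ φ(s) χ s`
vanishes on `S`, so `u` is the sum of the point masses `u (χ s)`. Their moduli form `m` and their
phases form the density. -/
theorem isMeasure_of_forall {u : 𝓢'(ℝ, ℂ)} {S : Set ℝ} (hS : UniformlyDiscrete S)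
    (h : ∀ φ : 𝓢(ℝ, ℂ), HasCompactSupport φ → (∀ s ∈ S, φ s = 0) → u φ = 0) :
    IsMeasure u := by
  classical
  obtain ⟨χ, hχc, hχ1, hχ0⟩ := hS.exists_interpolation
  have : Countable S := hS.countable.to_subtype
  have fin : ∀ {K : Set ℝ}, IsCompact K → {s : S | (s : ℝ) ∈ K}.Finite := fun {K} hK ↦
    Set.Finite.of_finite_image ((hS.finite_inter hK).subset (by
      rintro _ ⟨s, hs, rfl⟩
      exact ⟨s.2, hs⟩)) Subtype.val_injective.injOn
  let m : Measure ℝ := Measure.sum fun s : S ↦ ENNReal.ofReal ‖u (χ s)‖ • Measure.dirac (s : ℝ)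
  -- The value `1` elsewhere keeps the modulus equal to `1` everywhere; `m` gives those points no
  -- mass.
  let g : ℝ → ℂ := fun x ↦ if x ∈ S ∧ u (χ x) ≠ 0 then u (χ x) / ‖u (χ x)‖ else 1
  have hm : IsLocallyFiniteMeasure m := by
    refine ⟨fun x ↦ ⟨Metric.ball x 1, Metric.ball_mem_nhds x one_pos, ?_⟩⟩
    rw [Measure.sum_apply _ measurableSet_ball,
      tsum_eq_sum (s := (fin (isCompact_closedBall x 1)).toFinset)]
    · refine ENNReal.sum_lt_top.2 fun s _ ↦ ?_
      rw [Measure.smul_apply, smul_eq_mul]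
      exact ENNReal.mul_lt_top ENNReal.ofReal_lt_top (measure_lt_top _ _)
    · intro s hs
      rw [Set.Finite.mem_toFinset] at hs
      have : (s : ℝ) ∉ Metric.ball x 1 := fun h ↦ hs (Metric.ball_subset_closedBall h)
      simp [Measure.dirac_apply' _ measurableSet_ball, this]
  have hg1 : ∀ x, ‖g x‖ = 1 := by
    intro x
    by_cases hx : x ∈ S ∧ u (χ x) ≠ 0
    · simp only [g, if_pos hx]
      rw [norm_div, Complex.norm_real, norm_norm, div_self (norm_ne_zero_iff.2 hx.2)]
    · simp only [g, if_neg hx, norm_one]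
  have hgm : Measurable g := by
    refine (measurable_const (a := (1 : ℂ))).measurable_of_countable_ne
      (hS.countable.mono fun x hx ↦ ?_)
    by_contra hxS
    exact hx (if_neg fun h ↦ hxS h.1).symm
  have hgS : ∀ s : S, (‖u (χ s)‖ : ℂ) * g s = u (χ s) := by
    intro s
    by_cases hs : u (χ s) = 0
    · simp [hs]
    · simp only [g, if_pos (⟨s.2, hs⟩ : (s : ℝ) ∈ S ∧ u (χ s) ≠ 0)]
      exact mul_div_cancel₀ _ (Complex.ofReal_ne_zero.2 (norm_ne_zero_iff.2 hs))
  refine ⟨m, g, hm, hgm, hg1, fun φ hφ ↦ ?_⟩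
  set F : Finset S := (fin hφ.isCompact).toFinset with hF
  have hF0 : ∀ s ∉ F, φ (s : ℝ) = 0 := fun s hs ↦ by
    rw [hF, Set.Finite.mem_toFinset] at hs
    exact image_eq_zero_of_notMem_tsupport hs
  have hu : u φ = ∑ s ∈ F, φ (s : ℝ) * u (χ s) := by
    have hcs : HasCompactSupport (φ - ∑ s ∈ F, φ (s : ℝ) • χ s : 𝓢(ℝ, ℂ)) := by
      have hK : IsCompact (tsupport φ ∪ ⋃ s ∈ F, tsupport (χ s)) :=
        hφ.isCompact.union (F.isCompact_biUnion fun s _ ↦ (hχc s).isCompact)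
      refine HasCompactSupport.intro hK fun x hx ↦ ?_
      simp only [Set.mem_union, Set.mem_iUnion, not_or, not_exists] at hx
      rw [sub_apply, sum_apply, image_eq_zero_of_notMem_tsupport hx.1, zero_sub, neg_eq_zero]
      refine Finset.sum_eq_zero fun s hs ↦ ?_
      rw [smul_apply, image_eq_zero_of_notMem_tsupport (hx.2 s hs), smul_zero]
    have h0 := h _ hcs fun t ht ↦ by
      rw [sub_apply, sum_apply, Finset.sum_eq_single (⟨t, ht⟩ : S)]
      · simp [hχ1]
      · intro s _ hst
        rw [smul_apply, hχ0 s s.2 t ht fun h ↦ hst (Subtype.ext h.symm), smul_zero]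
      · intro hs
        rw [hF0 _ hs, zero_smul]; rfl
    rw [map_sub, sub_eq_zero, map_sum] at h0
    simpa using h0
  have hint : Integrable (fun x ↦ φ x * g x) m := by
    refine (φ.continuous.integrable_of_hasCompactSupport hφ).mono
      (φ.continuous.aestronglyMeasurable.mul hgm.aestronglyMeasurable)
      (Filter.Eventually.of_forall fun x ↦ ?_)
    rw [norm_mul, hg1, mul_one]
  have hsum := hasSum_integral_measure hint
  have heq : (fun s : S ↦ ∫ x, φ x * g x ∂(ENNReal.ofReal ‖u (χ s)‖ • Measure.dirac (s : ℝ))) =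
      fun s : S ↦ φ (s : ℝ) * u (χ s) := by
    ext s
    rw [integral_smul_measure, integral_dirac, ENNReal.toReal_ofReal (norm_nonneg _),
      Complex.real_smul]
    linear_combination φ (s : ℝ) * hgS s
  rw [heq] at hsum
  rw [hu]
  exact (hasSum_sum_of_ne_finset_zero fun s hs ↦ by rw [hF0 s hs, zero_mul]).unique hsum

/-! ### Complex conjugation -/

theorem conjDistribution_apply (ν : 𝓢'(ℝ, ℂ)) (φ : 𝓢(ℝ, ℂ)) :
    conjDistribution ν φ = starRingEnd ℂ (ν (conjS φ)) := rfl

theorem conjS_conjS (φ : 𝓢(ℝ, ℂ)) : conjS (conjS φ) = φ := by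
  ext x
  simp

theorem conjDistribution_conjS (ν : 𝓢'(ℝ, ℂ)) (φ : 𝓢(ℝ, ℂ)) :
    conjDistribution ν (conjS φ) = starRingEnd ℂ (ν φ) := by
  rw [conjDistribution_apply, conjS_conjS]

theorem conjDistribution_ne_zero {ν : 𝓢'(ℝ, ℂ)} (hν : ν ≠ 0) : conjDistribution ν ≠ 0 := by
  contrapose! hν
  ext φ
  have h := conjDistribution_conjS ν φ
  rw [hν] at h
  exact (map_eq_zero (starRingEnd ℂ)).1 h.symm

end MatrixWigner

theorem mainTheorem2 (T : (ℝ × ℝ) ≃ₗ[ℝ] (ℝ × ℝ)) (a b c d : ℝ)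
    (hT : ∀ u v : ℝ, T.symm (u, v) = (a * u + b * v, c * u + d * v))
    (hab : a * b ≠ 0)
    (μ ν : 𝓢'(ℝ, ℂ)) (hμ : μ ≠ 0) (hν : ν ≠ 0)
    (A B : Set ℝ) (hA : MatrixWigner.UniformlyDiscrete A) (hB : MatrixWigner.UniformlyDiscrete B)
    (coeff : ℝ × ℝ → ℂ)
    (hW : HasSum (fun p : (A ×ˢ B : Set (ℝ × ℝ)) ↦
        coeff p • TemperedDistribution.delta (p : ℝ × ℝ))
      (MatrixWigner.matrixWigner T μ ν)) :
    (MatrixWigner.IsMeasure μ ∧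
      ∃ S : Set ℝ, MatrixWigner.UniformlyDiscrete S ∧ Distribution.dsupport μ ⊆ S) ∧
    (MatrixWigner.IsMeasure ν ∧
      ∃ S : Set ℝ, MatrixWigner.UniformlyDiscrete S ∧ Distribution.dsupport ν ⊆ S) := by
  open MatrixWigner in
  have ha : a ≠ 0 := left_ne_zero_of_mul hab
  have hb : b ≠ 0 := right_ne_zero_of_mul hab
  have rel := fun (φ ψ : 𝓢(ℝ, ℂ)) (hφ : HasCompactSupport φ) (hψ : HasCompactSupport ψ) (r : ℝ) hr ↦
    tensor_relation (tensor_eq_zero_of_hasSum hT hW) hφ hψ (r := r) hr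
  obtain ⟨S, hS, hμS⟩ := eq_zero_of_hasCompactSupport_of_relation (conjDistribution_ne_zero hν)
    ha hb hA rel
  obtain ⟨S', hS', hνS'⟩ := eq_zero_of_hasCompactSupport_of_relation hμ hb ha hA
    (u := conjDistribution ν) fun φ ψ hφ hψ r hr ↦ by
      have h := rel ψ φ hψ hφ r fun x y hx hy hxy ↦ by
        rw [add_comm] at hxy ⊢
        exact hr y x hy hx hxy
      linear_combination h
  -- Conjugating a test function does not change its zeros, so the same set `S'` works for `ν`.
  have hν0 : ∀ φ : 𝓢(ℝ, ℂ), HasCompactSupport φ → (∀ s ∈ S', φ s = 0) → ν φ = 0 := by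
    intro φ hφ hφS
    have h := hνS' (conjS φ) (hφ.comp_left (map_zero (starRingEnd ℂ))) fun s hs ↦ by
      rw [conjS_apply, hφS s hs, map_zero]
    rw [conjDistribution_conjS] at h
    exact (map_eq_zero (starRingEnd ℂ)).1 h
  exact ⟨⟨isMeasure_of_forall hS hμS, S, hS, dsupport_subset_of_forall hS hμS⟩,
    isMeasure_of_forall hS' hν0, S', hS', dsupport_subset_of_forall hS' hν0⟩
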